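/- Let $\sigma_t$ be the permutation at time $t$ of a deck of $n$ cards which starts from $\sigma_0\in S_n$ and evolves by the top-to-random transposition shuffle: at every step a location $R_t$ is chosen uniformly from $\{1,\dots,n\}$, independently of the past, and the cards in location $1$ (the top) and in location $R_t$ are switched. For a set $S$ of $k$ cards let $d_S(t)$ be the maximum over $\sigma_0$ of the total variation distance between the joint law of the locations of the cards of $S$ in $\sigma_t$ and their joint law in a uniform permutation, and put $D_{n,k}(t)=\max_{|S|=k}d_S(t)$; a real time $t$ is rounded down to an integer, and a negative time is read as $0$. Let $k=k(n)$ be a sequence of non-negative integers. The shuffle is said to have $k$-partial cutoff at time $t_{\mathrm{mix}}(n)$ with a window of size $\omega(n)$ if $\omega=o(t_{\mathrm{mix}})$, \[\lim_{\alpha\to\infty}\limsup_{n\to\infty}D_{n,k}(t_{\mathrm{mix}}+\alpha\,\omega(n))=0\quad\text{and}\quad\lim_{\alpha\to-\infty}\liminf_{n\to\infty}D_{n,k}(t_{\mathrm{mix}}+\alpha\,\omega(n))=1.\] (1) If $k=o((n/\log n)^{1/2})$ and $k\to\infty$ as $n\to\infty$, then the top-to-random transposition shuffle has $k$-partial cutoff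 at time $n\log k$ with a window of size $\omega(n)=n$ (so of size $O(n)$). (2) If there is a constant $K$ with $k(n)<K$ for all $n$, then there is no cutoff: there are no real sequences $t_{\mathrm{mix}}$ and $\omega$ such that the shuffle has $k$-partial cutoff at time $t_{\mathrm{mix}}$ with a window of size $\omega$. -/

import Mathlib

open Filter Topology Asymptotics Equiv

noncomputable section

namespace CardShuffle

/-- The total variation distance `sup_A |p(A) - q(A)|` of two probability mass functions. -/
def tvDist {α : Type*} (p q : PMF α) : ℝ :=
  ⨆ A : Set α, |(p.toOuterMeasure A).toReal - (q.toOuterMeasure A).toReal|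

/-- A shuffle: for every number `n` of cards, every starting permutation and every time `t`,
the law of the permutation at time `t`.  A permutation `σ` of `Fin n` says that the card
`σ x` is in location `x`, so that the card `c` is in location `σ⁻¹ c`. -/
abbrev Shuffle : Type := (n : ℕ) → Perm (Fin n) → ℕ → PMF (Perm (Fin n))

/-- One step of the top-to-random transposition shuffle: the left hand chooses the top location
`0`, the right hand a uniform location `r`, and the cards in locations `0` and `r` are switched
(nothing happens if `r = 0`).  With no cards there is nothing to do. -/
def topToRandomStep : (n : ℕ) → Perm (Fin n) → PMF (Perm (Fin n))
  | 0, σ => PMF.pure σ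
  | m + 1, σ => (PMF.uniformOfFintype (Fin (m + 1))).map (fun r => σ * Equiv.swap 0 r)

/-- The top-to-random transposition shuffle (with independent choices of the right hand). -/
def topToRandom : Shuffle
  | _, σ₀, 0 => PMF.pure σ₀
  | n, σ₀, t + 1 => (topToRandom n σ₀ t).bind (topToRandomStep n)

/-- The joint law of the locations of the cards in `S`, for a random permutation with law `p`. -/
def locationLaw {n : ℕ} (S : Finset (Fin n)) (p : PMF (Perm (Fin n))) : PMF (S → Fin n) :=
  p.map (fun σ c => σ⁻¹ (c : Fin n))

/-- `d_S(t)`: the maximum over the starting permutations of the total variation distance between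
the joint law of the locations of the cards in `S` at time `t` and the one in a uniform
permutation. -/
def cardDist (P : Shuffle) {n : ℕ} (S : Finset (Fin n)) (t : ℕ) : ℝ :=
  ⨆ σ₀ : Perm (Fin n),
    tvDist (locationLaw S (P n σ₀ t))
      (locationLaw S (PMF.uniformOfFintype (Perm (Fin n))))

/-- The maximum of `d_S(t)` over all sets `S` of `k` of the `n` cards. A real time `t` is
rounded down to an integer (and a negative one is read as `0`). -/
def partialDist (P : Shuffle) (n k : ℕ) (t : ℝ) : ℝ :=
  ⨆ S : {S : Finset (Fin n) // S.card = k}, cardDist P S.1 ⌊t⌋₊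

/-- The shuffle `P` has `k`-partial cutoff at time `tmix` with a window of size `ω = o(tmix)`,
where `k`, `tmix` and `ω` may depend on the number `n` of cards. -/
structure HasPartialCutoff (P : Shuffle) (k : ℕ → ℕ) (tmix ω : ℕ → ℝ) : Prop where
  window : ω =o[atTop] tmix
  upper : Tendsto
    (fun α : ℝ => limsup (fun n : ℕ => partialDist P n (k n) (tmix n + α * ω n)) atTop)
    atTop (𝓝 0)
  lower : Tendsto
    (fun α : ℝ => liminf (fun n : ℕ => partialDist P n (k n) (tmix n + α * ω n)) atTop)
    atBot (𝓝 1)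

end CardShuffle

end

/-! Write n for the number of cards and k for the number of tracked ones. The state is the map from
cards to locations, and a step multiplies it on the left by `swap 0 r`. Probabilities of events
become iterates of `avgStep` on functions with values in [0, 1], so couplings turn into inductive
estimates on these iterates.

Upper bound (`avgStep_coupling`): two decks are run together. While no tracked card is on top, both
bring the same card to the top, which matches it, so u unmatched cards decay on average to u(1 -
1/n). A tracked card on top must be sent to the same location in both decks, at a cost O(k/n); this
situation arises with probability k/n per step, so it costs O(k²/n²) per step. The distance at time
s is then about k e^{-s/n} + 3sk²/n² + 2k/n. At s = n log k + αn the first term is about e^{-α}, and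
the growth condition on k makes the others vanish.

Lower bound (`iterate_avgStep_le_of_fixed`): a tracked card starting away from the top stays put
until its location is drawn. As in coupon collecting, all k have moved by time t with probability at
most (1 - (1 - 1/n)^t)^k, which is about exp(-e^{-α}) at that time, while in a uniform deck no
tracked card is at its initial location with probability at least 1 - k/n.

For bounded k > 0 the same two bounds show that the distance falls below 1/2 within O(n) steps but
stays bounded away from 0 throughout any fixed multiple of n steps. A cutoff is sharper than that,
and `partialDist_antitone` turns this into a contradiction. -/

namespace CardShuffle

/-! ### The transition operator on functions of the deck -/

/-- The transition operator of the shuffle on functions of the card-to-location map. -/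
noncomputable def avgStep {m : ℕ} (g : Perm (Fin (m + 1)) → ℝ) (x : Perm (Fin (m + 1))) : ℝ :=
  (∑ r, g (swap 0 r * x)) / ((m : ℝ) + 1)

theorem avgStep_mono {m : ℕ} {g h : Perm (Fin (m + 1)) → ℝ} (H : ∀ x, g x ≤ h x) (x) :
    avgStep g x ≤ avgStep h x := by
  unfold avgStep
  gcongr
  exact H _

theorem avgStep_const {m : ℕ} (a : ℝ) (x : Perm (Fin (m + 1))) :
    avgStep (fun _ => a) x = a := by
  unfold avgStep
  simp only [Finset.sum_const, Finset.card_univ, Fintype.card_fin, nsmul_eq_mul]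
  push_cast
  field_simp

theorem iterate_avgStep_mem_Icc {m : ℕ} {g : Perm (Fin (m + 1)) → ℝ} {a b : ℝ}
    (H : ∀ x, g x ∈ Set.Icc a b) (t : ℕ) (x) : avgStep^[t] g x ∈ Set.Icc a b := by
  induction t generalizing x with
  | zero => exact H x
  | succ t ih =>
    rw [Function.iterate_succ_apply']
    constructor
    · rw [← avgStep_const (m := m) a x]
      exact avgStep_mono (fun y => (ih y).1) x
    · rw [← avgStep_const (m := m) b x]
      exact avgStep_mono (fun y => (ih y).2) x

/-- Left multiplication by a transposition permutes the decks: the uniform law is stationary. -/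
theorem sum_iterate_avgStep {m : ℕ} (g : Perm (Fin (m + 1)) → ℝ) (t : ℕ) :
    ∑ x, avgStep^[t] g x = ∑ x, g x := by
  induction t with
  | zero => rfl
  | succ t ih =>
    rw [Function.iterate_succ_apply', ← ih]
    simp only [avgStep.eq_def (avgStep^[t] g)]
    rw [← Finset.sum_div, Finset.sum_comm]
    have : ∀ r : Fin (m + 1), ∑ x, avgStep^[t] g (swap 0 r * x) = ∑ x, avgStep^[t] g x :=
      fun r => Fintype.sum_equiv (Equiv.mulLeft (swap 0 r)) _ _ (fun _ => rfl)
    change (∑ r, ∑ x, avgStep^[t] g (swap 0 r * x)) / _ = _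
    rw [Finset.sum_congr rfl (fun r _ => this r)]
    simp only [Finset.sum_const, Finset.card_univ, Fintype.card_fin, nsmul_eq_mul]
    push_cast
    field_simp

/-! ### Coupling two decks -/

/-- Comparing the averages over two sets of successors paired by a permutation. -/
theorem abs_avgStep_sub_le {m : ℕ} (g : Perm (Fin (m + 1)) → ℝ) (x y : Perm (Fin (m + 1)))
    (p q : Perm (Fin (m + 1))) (B : Fin (m + 1) → ℝ)
    (H : ∀ c, |g (swap 0 (p c) * x) - g (swap 0 (q c) * y)| ≤ B c) :
    |avgStep g x - avgStep g y| ≤ (∑ c, B c) / ((m : ℝ) + 1) := by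
  have hx : avgStep g x = (∑ c, g (swap 0 (p c) * x)) / ((m : ℝ) + 1) := by
    unfold avgStep
    rw [Equiv.sum_comp p (fun r => g (swap 0 r * x))]
  have hy : avgStep g y = (∑ c, g (swap 0 (q c) * y)) / ((m : ℝ) + 1) := by
    unfold avgStep
    rw [Equiv.sum_comp q (fun r => g (swap 0 r * y))]
  rw [hx, hy, ← sub_div, ← Finset.sum_sub_distrib, abs_div,
    abs_of_pos (by positivity : (0 : ℝ) < (m : ℝ) + 1)]
  gcongr
  exact (Finset.abs_sum_le_sum_abs _ _).trans (Finset.sum_le_sum fun c _ => H c)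

theorem swap_mul_apply_of_ne {m : ℕ} {x : Perm (Fin (m + 1))} {r d : Fin (m + 1)}
    (h0 : x d ≠ 0) (hr : x d ≠ r) : (swap 0 r * x) d = x d := by
  rw [Perm.mul_apply, swap_apply_of_ne_of_ne h0 hr]

theorem swap_mul_apply_eq_zero {m : ℕ} {x : Perm (Fin (m + 1))} {r d : Fin (m + 1)} :
    (swap 0 r * x) d = 0 ↔ x d = r := by
  rw [Perm.mul_apply, Equiv.swap_apply_eq_iff, swap_apply_left]

/-- The cards of `S` whose locations differ. -/
def unmatched {m : ℕ} (S : Finset (Fin (m + 1))) (x y : Perm (Fin (m + 1))) :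
    Finset (Fin (m + 1)) := S.filter fun c => x c ≠ y c

theorem mem_unmatched {m : ℕ} {S : Finset (Fin (m + 1))} {x y : Perm (Fin (m + 1))} {c} :
    c ∈ unmatched S x y ↔ c ∈ S ∧ x c ≠ y c := Finset.mem_filter

theorem sum_indicator_image {m : ℕ} (x : Perm (Fin (m + 1))) (U : Finset (Fin (m + 1))) (a : ℝ) :
    ∑ r, (if x.symm r ∈ U then a else 0) = U.card * a := by
  rw [Equiv.sum_comp x.symm (fun c => if c ∈ U then a else 0)]
  simp

/-- The induction runs over the first step of the two decks, whose tracked cards agree about being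
on top. The three terms are the expected number of cards still unmatched, the accumulated cost of
later visits of tracked cards to the top, and the cost of such a visit right now. -/
theorem avgStep_coupling {m : ℕ} (S : Finset (Fin (m + 1))) (g : Perm (Fin (m + 1)) → ℝ)
    (h01 : ∀ x, g x ∈ Set.Icc (0 : ℝ) 1)
    (hg : ∀ x y, (∀ c ∈ S, x c = y c) → g x = g y) (t : ℕ) (x y : Perm (Fin (m + 1)))
    (hxy : ∀ c ∈ S, x c = 0 ↔ y c = 0) :
    |avgStep^[t] g x - avgStep^[t] g y| ≤
      (unmatched S x y).card * (1 - 1 / ((m : ℝ) + 1)) ^ t +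
      t * (3 * S.card ^ 2 / ((m : ℝ) + 1) ^ 2) +
      (if x.symm 0 ∈ S then 3 * S.card / ((m : ℝ) + 1) else 0) := by
  have hm : (0 : ℝ) < (m : ℝ) + 1 := by positivity
  have hl0 : (0 : ℝ) ≤ 1 - 1 / ((m : ℝ) + 1) := by
    rw [sub_nonneg, div_le_one hm]
    linarith [Nat.cast_nonneg (α := ℝ) m]
  have hl1 : 1 - 1 / ((m : ℝ) + 1) ≤ 1 := by
    have : 0 < 1 / ((m : ℝ) + 1) := by positivity
    linarith
  induction t generalizing x y with
  | zero =>
    have hnn : (0 : ℝ) ≤ (if x.symm 0 ∈ S then 3 * S.card / ((m : ℝ) + 1) else 0) := by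
      split_ifs <;> positivity
    simp only [Function.iterate_zero, id, pow_zero, mul_one, Nat.cast_zero, zero_mul, add_zero]
    rcases Finset.eq_empty_or_nonempty (unmatched S x y) with he | hne
    · rw [hg x y, sub_self, abs_zero]
      · positivity
      · intro c hc
        by_contra hcc
        have : c ∈ unmatched S x y := mem_unmatched.2 ⟨hc, hcc⟩
        simp [he] at this
    · have h1 : (1 : ℝ) ≤ (unmatched S x y).card := by exact_mod_cast hne.card_pos
      have := h01 x
      have := h01 y
      have : |g x - g y| ≤ 1 := abs_sub_le_iff.2 ⟨by grind, by grind⟩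
      linarith
  | succ t ih =>
    set l := 1 - 1 / ((m : ℝ) + 1) with hl
    set k : ℝ := (S.card : ℝ) with hk
    set δ := 3 * k ^ 2 / ((m : ℝ) + 1) ^ 2 with hδ
    set u : ℝ := ((unmatched S x y).card : ℝ) with hu
    have hk0 : 0 ≤ k := by positivity
    have hu0 : 0 ≤ u := by positivity
    have huk : u ≤ k := by
      exact Nat.cast_le.2 (Finset.card_le_card (Finset.filter_subset _ _))
    have hpow0 : 0 ≤ l ^ t := pow_nonneg hl0 t
    have hpow1 : l ^ t ≤ 1 := pow_le_one₀ hl0 hl1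
    rw [Function.iterate_succ_apply']
    by_cases htop : x.symm 0 ∈ S
    · rw [if_pos htop]
      obtain ⟨c₀, hc₀⟩ : ∃ c₀, c₀ = x.symm 0 := ⟨_, rfl⟩
      rw [← hc₀] at htop
      have hxc : x c₀ = 0 := by simp [hc₀]
      have hyc : y c₀ = 0 := (hxy c₀ htop).1 hxc
      have hU0 : ∀ d ∈ unmatched S x y, x d ≠ 0 ∧ y d ≠ 0 := by
        intro d hd
        rw [mem_unmatched] at hd
        refine ⟨fun h => hd.2 ?_, fun h => hd.2 ?_⟩
        · rw [h, (hxy d hd.1).1 h]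
        · rw [h, (hxy d hd.1).2 h]
      -- Both decks draw the same location, which keeps the top card matched. A draw that hits an
      -- unmatched card in either deck is given up, with probability at most 2k/n; the third k/n
      -- pays for the missing decay of the first term.
      have key := abs_avgStep_sub_le (avgStep^[t] g) x y 1 1
        (fun r => (u * l ^ t + t * δ) + (if x.symm r ∈ S then 3 * k / ((m : ℝ) + 1) else 0) +
          (if x.symm r ∈ unmatched S x y then 1 else 0) +
          (if y.symm r ∈ unmatched S x y then 1 else 0)) ?_
      · refine key.trans ?_
        rw [Finset.sum_add_distrib, Finset.sum_add_distrib, Finset.sum_add_distrib,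
          sum_indicator_image, sum_indicator_image, sum_indicator_image]
        simp only [Finset.sum_const, Finset.card_univ, Fintype.card_fin, nsmul_eq_mul]
        push_cast
        rw [← hu, ← hk]
        have e : (((m : ℝ) + 1) * (u * l ^ t + t * δ) + k * (3 * k / ((m : ℝ) + 1)) + u * 1 + u * 1)
            / ((m : ℝ) + 1) = u * l ^ t + t * δ + δ + 2 * u / ((m : ℝ) + 1) := by
          rw [hδ]; field_simp; ring
        rw [e]
        have e2 : u * l ^ (t + 1) = u * l ^ t - u * l ^ t / ((m : ℝ) + 1) := by
          rw [pow_succ, hl]; field_simp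
        rw [e2]
        have e3 : u * l ^ t / ((m : ℝ) + 1) ≤ k / ((m : ℝ) + 1) := by
          gcongr; nlinarith
        have e4 : 2 * u / ((m : ℝ) + 1) ≤ 2 * k / ((m : ℝ) + 1) := by gcongr
        have e5 : 3 * k / ((m : ℝ) + 1) = k / ((m : ℝ) + 1) + 2 * k / ((m : ℝ) + 1) := by ring
        linarith
      · intro r
        simp only [Perm.one_apply]
        have nn1 : (0 : ℝ) ≤ (if x.symm r ∈ S then 3 * k / ((m : ℝ) + 1) else 0) := by
          split_ifs <;> positivity
        have nn2 : (0 : ℝ) ≤ (if x.symm r ∈ unmatched S x y then 1 else 0) := by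
          split_ifs <;> positivity
        have nn3 : (0 : ℝ) ≤ (if y.symm r ∈ unmatched S x y then 1 else 0) := by
          split_ifs <;> positivity
        have nn4 : 0 ≤ u * l ^ t + t * δ := by positivity
        by_cases hbad : x.symm r ∈ unmatched S x y ∨ y.symm r ∈ unmatched S x y
        · have h1 := iterate_avgStep_mem_Icc h01 t (swap 0 r * x)
          have h2 := iterate_avgStep_mem_Icc h01 t (swap 0 r * y)
          have h3 : |avgStep^[t] g (swap 0 r * x) - avgStep^[t] g (swap 0 r * y)| ≤ 1 :=
            abs_sub_le_iff.2 ⟨by grind, by grind⟩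
          rcases hbad with hb | hb
          · rw [if_pos hb] at nn2 ⊢; linarith
          · rw [if_pos hb] at nn3 ⊢; linarith
        · push Not at hbad
          have hUr : ∀ d ∈ unmatched S x y, x d ≠ r ∧ y d ≠ r := by
            intro d hd
            refine ⟨fun h => hbad.1 ?_, fun h => hbad.2 ?_⟩
            · rwa [← h, symm_apply_apply]
            · rwa [← h, symm_apply_apply]
          have hsub : unmatched S (swap 0 r * x) (swap 0 r * y) ⊆ unmatched S x y := by
            intro d hd
            rw [mem_unmatched] at hd ⊢
            exact ⟨hd.1, fun h => hd.2 (by rw [Perm.mul_apply, Perm.mul_apply, h])⟩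
          have hcomp : ∀ c ∈ S, (swap 0 r * x) c = 0 ↔ (swap 0 r * y) c = 0 := by
            intro d hd
            rw [swap_mul_apply_eq_zero, swap_mul_apply_eq_zero]
            by_cases hdu : d ∈ unmatched S x y
            · exact iff_of_false (hUr d hdu).1 (hUr d hdu).2
            · have : x d = y d := by
                by_contra h
                exact hdu (mem_unmatched.2 ⟨hd, h⟩)
              rw [this]
          have hi := ih _ _ hcomp
          have hs : (swap 0 r * x).symm 0 = x.symm r := by
            rw [Equiv.symm_apply_eq]
            exact (swap_mul_apply_eq_zero.2 (by simp)).symm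
          rw [hs] at hi
          have hc : ((unmatched S (swap 0 r * x) (swap 0 r * y)).card : ℝ) ≤ u := by
            exact Nat.cast_le.2 (Finset.card_le_card hsub)
          have hc' := mul_le_mul_of_nonneg_right hc hpow0
          linarith
    · rw [if_neg htop]
      have hx0 : ∀ d ∈ S, x d ≠ 0 := by
        intro d hd h
        exact htop (by rwa [← h, symm_apply_apply])
      have hy0 : ∀ d ∈ S, y d ≠ 0 := fun d hd h => hx0 d hd ((hxy d hd).2 h)
      -- Both decks draw the location of the same card `c`, which becomes matched at the top. The
      -- displaced top cards are untracked, so no new mismatch arises.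
      have key := abs_avgStep_sub_le (avgStep^[t] g) x y x y
        (fun c => (u * l ^ t + t * δ) + (if c ∈ S then 3 * k / ((m : ℝ) + 1) else 0) +
          (if c ∈ unmatched S x y then - l ^ t else 0)) ?_
      · refine key.trans (le_of_eq ?_)
        rw [Finset.sum_add_distrib, Finset.sum_add_distrib]
        simp only [Finset.sum_const, Finset.card_univ, Fintype.card_fin, nsmul_eq_mul,
          Finset.sum_ite_mem, Finset.univ_inter]
        push_cast
        have e2 : l ^ (t + 1) = l ^ t - l ^ t / ((m : ℝ) + 1) := by
          rw [pow_succ, hl]; field_simp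
        rw [← hu, ← hk, hδ, e2]
        field_simp
        ring
      · intro c
        have hx' : ∀ d ∈ S, d ≠ c → (swap 0 (x c) * x) d = x d := fun d hd hdc =>
          swap_mul_apply_of_ne (hx0 d hd) (fun h => hdc (x.injective h))
        have hy' : ∀ d ∈ S, d ≠ c → (swap 0 (y c) * y) d = y d := fun d hd hdc =>
          swap_mul_apply_of_ne (hy0 d hd) (fun h => hdc (y.injective h))
        have hxc : (swap 0 (x c) * x) c = 0 := swap_mul_apply_eq_zero.2 rfl
        have hyc : (swap 0 (y c) * y) c = 0 := swap_mul_apply_eq_zero.2 rfl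
        have hsub : unmatched S (swap 0 (x c) * x) (swap 0 (y c) * y) ⊆
            (unmatched S x y).erase c := by
          intro d hd
          rw [mem_unmatched] at hd
          have hdc : d ≠ c := fun h => hd.2 (by rw [h, hxc, hyc])
          rw [Finset.mem_erase, mem_unmatched]
          refine ⟨hdc, hd.1, ?_⟩
          rw [← hx' d hd.1 hdc, ← hy' d hd.1 hdc]
          exact hd.2
        have hcomp : ∀ d ∈ S, (swap 0 (x c) * x) d = 0 ↔ (swap 0 (y c) * y) d = 0 := by
          intro d hd
          rw [swap_mul_apply_eq_zero, swap_mul_apply_eq_zero, x.injective.eq_iff,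
            y.injective.eq_iff]
        have hi := ih _ _ hcomp
        have hs : (swap 0 (x c) * x).symm 0 = c := by
          rw [Equiv.symm_apply_eq, hxc]
        rw [hs] at hi
        have hc : ((unmatched S (swap 0 (x c) * x) (swap 0 (y c) * y)).card : ℝ) ≤
            u + (if c ∈ unmatched S x y then -1 else 0) := by
          have h1 := Finset.card_le_card hsub
          split_ifs with h
          · have h2 := Finset.card_erase_add_one h
            have h3 : (unmatched S (swap 0 (x c) * x) (swap 0 (y c) * y)).card + 1 ≤
              (unmatched S x y).card := by omega
            have h4 : ((unmatched S (swap 0 (x c) * x) (swap 0 (y c) * y)).card : ℝ) + 1 ≤ u := by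
              rw [hu]
              exact_mod_cast h3
            linarith
          · rw [Finset.erase_eq_of_notMem h] at h1
            rw [add_zero]
            exact Nat.cast_le.2 h1
        have hc' := mul_le_mul_of_nonneg_right hc hpow0
        have e : (u + (if c ∈ unmatched S x y then (-1 : ℝ) else 0)) * l ^ t =
            u * l ^ t + (if c ∈ unmatched S x y then - l ^ t else 0) := by
          split_ifs <;> ring
        rw [e] at hc'
        linarith

/-- One preliminary step with a common location puts an untracked card on top of both decks, except
with probability at most 2k/n; this supplies the compatibility needed by `avgStep_coupling`. -/
theorem abs_iterate_avgStep_sub_le {m : ℕ} (S : Finset (Fin (m + 1)))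
    (g : Perm (Fin (m + 1)) → ℝ) (h01 : ∀ x, g x ∈ Set.Icc (0 : ℝ) 1)
    (hg : ∀ x y, (∀ c ∈ S, x c = y c) → g x = g y) (t : ℕ) (x y : Perm (Fin (m + 1))) :
    |avgStep^[t + 1] g x - avgStep^[t + 1] g y| ≤
      S.card * (1 - 1 / ((m : ℝ) + 1)) ^ t + t * (3 * S.card ^ 2 / ((m : ℝ) + 1) ^ 2) +
      2 * S.card / ((m : ℝ) + 1) := by
  have hl0 : (0 : ℝ) ≤ 1 - 1 / ((m : ℝ) + 1) := by
    rw [sub_nonneg, div_le_one (by positivity)]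
    linarith [Nat.cast_nonneg (α := ℝ) m]
  rw [Function.iterate_succ_apply']
  set b := S.card * (1 - 1 / ((m : ℝ) + 1)) ^ t + t * (3 * S.card ^ 2 / ((m : ℝ) + 1) ^ 2) with hb
  have hb0 : 0 ≤ b := by positivity
  have key := abs_avgStep_sub_le (avgStep^[t] g) x y 1 1
    (fun r => b + (if x.symm r ∈ S then 1 else 0) + (if y.symm r ∈ S then 1 else 0)) ?_
  · refine key.trans (le_of_eq ?_)
    rw [Finset.sum_add_distrib, Finset.sum_add_distrib, sum_indicator_image, sum_indicator_image]
    simp only [Finset.sum_const, Finset.card_univ, Fintype.card_fin, nsmul_eq_mul]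
    push_cast
    field_simp
    ring
  · intro r
    simp only [Perm.one_apply]
    have nn2 : (0 : ℝ) ≤ (if x.symm r ∈ S then 1 else 0) := by split_ifs <;> positivity
    have nn3 : (0 : ℝ) ≤ (if y.symm r ∈ S then 1 else 0) := by split_ifs <;> positivity
    by_cases hbad : x.symm r ∈ S ∨ y.symm r ∈ S
    · have h1 := iterate_avgStep_mem_Icc h01 t (swap 0 r * x)
      have h2 := iterate_avgStep_mem_Icc h01 t (swap 0 r * y)
      have h3 : |avgStep^[t] g (swap 0 r * x) - avgStep^[t] g (swap 0 r * y)| ≤ 1 :=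
        abs_sub_le_iff.2 ⟨by grind, by grind⟩
      rcases hbad with hb | hb
      · rw [if_pos hb] at nn2 ⊢; linarith
      · rw [if_pos hb] at nn3 ⊢; linarith
    · push Not at hbad
      rw [if_neg hbad.1, if_neg hbad.2, add_zero, add_zero]
      have hs : (swap 0 r * x).symm 0 = x.symm r := by
        rw [Equiv.symm_apply_eq]
        exact (swap_mul_apply_eq_zero.2 (by simp)).symm
      have hi := avgStep_coupling S g h01 hg t (swap 0 r * x) (swap 0 r * y) (by
        intro d hd
        rw [swap_mul_apply_eq_zero, swap_mul_apply_eq_zero]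
        refine iff_of_false (fun h => hbad.1 ?_) (fun h => hbad.2 ?_)
        · rwa [← h, symm_apply_apply]
        · rwa [← h, symm_apply_apply])
      rw [hs, if_neg hbad.1, add_zero] at hi
      refine hi.trans ?_
      rw [hb]
      gcongr
      exact Finset.filter_subset _ _

/-! ### Coupon collecting -/

/-- The coupon-collector bound: if the cards of `W` are at their locations under `z`, away from
the top, then the probability that all of them leave by time `t` is at most
`(1 - (1 - 1 / n) ^ t) ^ |W|`. -/
theorem iterate_avgStep_le_of_fixed {m : ℕ} (z : Perm (Fin (m + 1)))
    (h : Perm (Fin (m + 1)) → ℝ) (h01 : ∀ x, h x ∈ Set.Icc (0 : ℝ) 1) (S : Finset (Fin (m + 1)))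
    (hz : ∀ c ∈ S, z c ≠ 0) (hh : ∀ y, (∃ c ∈ S, y c = z c) → h y = 0) (t : ℕ)
    (y : Perm (Fin (m + 1))) (W : Finset (Fin (m + 1))) (hW : W ⊆ S) (hy : ∀ c ∈ W, y c = z c) :
    avgStep^[t] h y ≤ (1 - (1 - 1 / ((m : ℝ) + 1)) ^ t) ^ W.card := by
  have hm : (0 : ℝ) < (m : ℝ) + 1 := by positivity
  have hl0 : (0 : ℝ) ≤ 1 - 1 / ((m : ℝ) + 1) := by
    rw [sub_nonneg, div_le_one hm]
    linarith [Nat.cast_nonneg (α := ℝ) m]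
  have hl1 : 1 - 1 / ((m : ℝ) + 1) ≤ 1 := by
    have : 0 < 1 / ((m : ℝ) + 1) := by positivity
    linarith
  induction t generalizing y W with
  | zero =>
    rcases Finset.eq_empty_or_nonempty W with rfl | ⟨c, hc⟩
    · simpa using (h01 y).2
    · have : h y = 0 := hh y ⟨c, hW hc, hy c hc⟩
      simp only [Function.iterate_zero, id, this]
      simp
  | succ t ih =>
    rw [Function.iterate_succ_apply']
    set l := 1 - 1 / ((m : ℝ) + 1) with hl
    set a := 1 - l ^ t with ha
    have ha0 : 0 ≤ a := sub_nonneg.2 (pow_le_one₀ hl0 hl1)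
    have ha1 : a ≤ 1 := by
      have := pow_nonneg hl0 t
      linarith
    have step : avgStep (avgStep^[t] h) y ≤
        (∑ r, (a ^ W.card + if y.symm r ∈ W then a ^ (W.card - 1) - a ^ W.card else 0)) /
          ((m : ℝ) + 1) := by
      unfold avgStep
      gcongr with r
      split_ifs with hr
      · obtain ⟨c, rfl⟩ : ∃ c, r = y c := ⟨y.symm r, by simp⟩
        rw [symm_apply_apply] at hr
        rw [add_sub_cancel, ← Finset.card_erase_of_mem hr]
        refine ih _ _ ((Finset.erase_subset _ _).trans hW) ?_
        intro d hd
        rw [Finset.mem_erase] at hd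
        rw [swap_mul_apply_of_ne, hy d hd.2]
        · rw [hy d hd.2]
          exact hz d (hW hd.2)
        · exact fun h => hd.1 (y.injective h)
      · rw [add_zero]
        refine ih _ _ hW ?_
        intro d hd
        rw [swap_mul_apply_of_ne, hy d hd]
        · rw [hy d hd]
          exact hz d (hW hd)
        · rintro rfl
          exact hr (by rwa [symm_apply_apply])
    refine step.trans ?_
    rw [Finset.sum_add_distrib, sum_indicator_image]
    simp only [Finset.sum_const, Finset.card_univ, Fintype.card_fin, nsmul_eq_mul]
    have e : 1 - l ^ (t + 1) = a + (1 - a) / ((m : ℝ) + 1) := by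
      rw [pow_succ, ha, hl]; field_simp; ring
    rw [e]
    rcases Nat.eq_zero_or_pos W.card with h0 | hpos
    · rw [h0]
      push_cast
      rw [div_le_iff₀ hm]
      simp
    · obtain ⟨j, hj⟩ : ∃ j, W.card = j + 1 := ⟨W.card - 1, by omega⟩
      rw [hj, Nat.add_sub_cancel]
      have hb : 0 ≤ (1 - a) / ((m : ℝ) + 1) := div_nonneg (by linarith) hm.le
      -- With j + 1 cards in place the step gives a^(j+1) + (j+1) a^j (1 - a)/n: the first two terms
      -- in the expansion of (a + (1 - a)/n)^(j+1).
      have bern := (Commute.all a ((1 - a) / ((m : ℝ) + 1))).pow_add_mul_le_add_pow_of_sq_nonneg ha0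
        (sq_nonneg _) (sq_nonneg _) (by linarith) (j + 1)
      refine le_trans (le_of_eq ?_) bern
      push_cast
      field_simp
      ring

/-! ### From probability mass functions to the transition operator -/

/-- The expectation of a real function under a probability mass function on a finite type. -/
noncomputable def expect {α : Type*} [Fintype α] (p : PMF α) (f : α → ℝ) : ℝ :=
  ∑ a, (p a).toReal * f a

theorem expect_pure {α : Type*} [Fintype α] (a : α) (f : α → ℝ) :
    expect (PMF.pure a) f = f a := by
  classical
  unfold expect
  rw [Finset.sum_eq_single a]
  · simp
  · intro b _ hb
    simp [PMF.pure_apply, hb]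
  · simp

theorem expect_bind {α β : Type*} [Fintype α] [Fintype β] (p : PMF α) (q : α → PMF β)
    (f : β → ℝ) : expect (p.bind q) f = expect p (fun a => expect (q a) f) := by
  unfold expect
  simp_rw [Finset.mul_sum]
  rw [Finset.sum_comm]
  refine Finset.sum_congr rfl fun b _ => ?_
  rw [PMF.bind_apply, tsum_fintype, ENNReal.toReal_sum]
  · rw [Finset.sum_mul]
    refine Finset.sum_congr rfl fun a _ => ?_
    rw [ENNReal.toReal_mul, mul_assoc]
  · intro a _
    exact ENNReal.mul_ne_top (PMF.apply_ne_top _ _) (PMF.apply_ne_top _ _)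

theorem expect_map {α β : Type*} [Fintype α] [Fintype β] (p : PMF α) (h : α → β)
    (f : β → ℝ) : expect (p.map h) f = expect p (fun a => f (h a)) := by
  rw [PMF.map, expect_bind]
  simp only [Function.comp_apply, expect_pure]

theorem expect_uniform {α : Type*} [Fintype α] [Nonempty α] (f : α → ℝ) :
    expect (PMF.uniformOfFintype α) f = (∑ a, f a) / Fintype.card α := by
  unfold expect
  simp only [PMF.uniformOfFintype_apply, ENNReal.toReal_inv, ENNReal.toReal_natCast]
  rw [← Finset.mul_sum, inv_mul_eq_div]

theorem toReal_toOuterMeasure {α : Type*} [Fintype α] (p : PMF α) (A : Set α) :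
    (p.toOuterMeasure A).toReal = expect p (A.indicator 1) := by
  classical
  rw [PMF.toOuterMeasure_apply_fintype, ENNReal.toReal_sum]
  · refine Finset.sum_congr rfl fun a _ => ?_
    by_cases h : a ∈ A <;> simp [h]
  · intro a _
    by_cases h : a ∈ A <;> simp [h, PMF.apply_ne_top]

/-- The inverse of `τ * swap 0 r` is `swap 0 r * τ⁻¹`, so the law of the inverse deck evolves by
`avgStep`. -/
theorem expect_topToRandom {m : ℕ} (σ : Perm (Fin (m + 1))) (t : ℕ)
    (g : Perm (Fin (m + 1)) → ℝ) :
    expect (topToRandom (m + 1) σ t) (fun τ => g τ⁻¹) = avgStep^[t] g σ⁻¹ := by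
  induction t generalizing g with
  | zero => exact expect_pure _ _
  | succ t ih =>
    rw [Function.iterate_succ_apply, ← ih, topToRandom, expect_bind]
    congr 1
    funext τ
    rw [topToRandomStep, expect_map, expect_uniform, avgStep]
    simp

theorem toReal_toOuterMeasure_mem_Icc {α : Type*} (p : PMF α) (A : Set α) :
    (p.toOuterMeasure A).toReal ∈ Set.Icc (0 : ℝ) 1 := by
  have h : p.toOuterMeasure A ≤ 1 := by
    rw [PMF.toOuterMeasure_apply, ← p.tsum_coe]
    exact ENNReal.tsum_le_tsum fun a => Set.indicator_le_self _ _ _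
  exact ⟨ENNReal.toReal_nonneg, by simpa using ENNReal.toReal_mono ENNReal.one_ne_top h⟩

theorem abs_sub_le_one_of_mem_Icc {a b : ℝ} (ha : a ∈ Set.Icc (0 : ℝ) 1)
    (hb : b ∈ Set.Icc (0 : ℝ) 1) : |a - b| ≤ 1 :=
  abs_sub_le_iff.2 ⟨by linarith [ha.2, hb.1], by linarith [ha.1, hb.2]⟩

theorem le_tvDist {α : Type*} (p q : PMF α) (A : Set α) :
    |(p.toOuterMeasure A).toReal - (q.toOuterMeasure A).toReal| ≤ tvDist p q := by
  refine le_ciSup (f := fun A : Set α =>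
    |(p.toOuterMeasure A).toReal - (q.toOuterMeasure A).toReal|) ⟨1, ?_⟩ A
  rintro _ ⟨B, rfl⟩
  exact abs_sub_le_one_of_mem_Icc (toReal_toOuterMeasure_mem_Icc p B)
    (toReal_toOuterMeasure_mem_Icc q B)

theorem tvDist_nonneg {α : Type*} (p q : PMF α) : 0 ≤ tvDist p q :=
  (abs_nonneg _).trans (le_tvDist p q ∅)

theorem tvDist_le_one {α : Type*} (p q : PMF α) : tvDist p q ≤ 1 :=
  ciSup_le fun A => abs_sub_le_one_of_mem_Icc (toReal_toOuterMeasure_mem_Icc p A)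
    (toReal_toOuterMeasure_mem_Icc q A)

theorem le_cardDist (P : Shuffle) {n : ℕ} (S : Finset (Fin n)) (t : ℕ) (σ : Perm (Fin n)) :
    tvDist (locationLaw S (P n σ t)) (locationLaw S (PMF.uniformOfFintype (Perm (Fin n)))) ≤
      cardDist P S t :=
  le_ciSup (f := fun σ => tvDist (locationLaw S (P n σ t))
    (locationLaw S (PMF.uniformOfFintype (Perm (Fin n))))) (Set.finite_range _).bddAbove σ

theorem le_partialDist (P : Shuffle) {n : ℕ} (S : Finset (Fin n)) (t : ℝ) :
    cardDist P S ⌊t⌋₊ ≤ partialDist P n S.card t :=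
  le_ciSup (f := fun S' : {S' : Finset (Fin n) // S'.card = S.card} => cardDist P S'.1 ⌊t⌋₊)
    (Set.finite_range _).bddAbove ⟨S, rfl⟩

theorem partialDist_le (P : Shuffle) {n k : ℕ} (t : ℝ) {b : ℝ} (hb : 0 ≤ b)
    (H : ∀ S : Finset (Fin n), S.card = k → cardDist P S ⌊t⌋₊ ≤ b) :
    partialDist P n k t ≤ b :=
  Real.iSup_le (fun S => H S.1 S.2) hb

theorem partialDist_nonneg (P : Shuffle) (n k : ℕ) (t : ℝ) : 0 ≤ partialDist P n k t :=
  Real.iSup_nonneg fun _ => Real.iSup_nonneg fun _ => tvDist_nonneg _ _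

theorem partialDist_le_one (P : Shuffle) (n k : ℕ) (t : ℝ) : partialDist P n k t ≤ 1 :=
  partialDist_le P t zero_le_one fun _ _ => ciSup_le fun _ => tvDist_le_one _ _

/-- The event that the cards in `S` are located according to `A`, as a function of the
card-to-location map. -/
noncomputable def locationIndicator {n : ℕ} {S : Finset (Fin n)} (A : Set (S → Fin n))
    (x : Perm (Fin n)) : ℝ :=
  A.indicator 1 (fun c : S => x c)

theorem locationIndicator_mem_Icc {n : ℕ} {S : Finset (Fin n)} (A : Set (S → Fin n)) (x) :
    locationIndicator A x ∈ Set.Icc (0 : ℝ) 1 := by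
  unfold locationIndicator
  by_cases h : (fun c : S => x c) ∈ A <;> simp [h]

theorem locationIndicator_congr {n : ℕ} {S : Finset (Fin n)} (A : Set (S → Fin n))
    (x y : Perm (Fin n)) (h : ∀ c ∈ S, x c = y c) :
    locationIndicator A x = locationIndicator A y := by
  unfold locationIndicator
  congr 1
  funext c
  exact h c c.2

theorem locationLaw_topToRandom {m : ℕ} {S : Finset (Fin (m + 1))} (A : Set (S → Fin (m + 1)))
    (σ : Perm (Fin (m + 1))) (t : ℕ) :
    ((locationLaw S (topToRandom (m + 1) σ t)).toOuterMeasure A).toReal =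
      avgStep^[t] (locationIndicator A) σ⁻¹ := by
  rw [toReal_toOuterMeasure, locationLaw, expect_map, ← expect_topToRandom]
  rfl

theorem locationLaw_uniform {n : ℕ} {S : Finset (Fin n)} (A : Set (S → Fin n)) :
    ((locationLaw S (PMF.uniformOfFintype (Perm (Fin n)))).toOuterMeasure A).toReal =
      (∑ x, locationIndicator A x) / Fintype.card (Perm (Fin n)) := by
  rw [toReal_toOuterMeasure, locationLaw, expect_map, expect_uniform]
  congr 1
  exact Equiv.sum_comp (Equiv.inv (Perm (Fin n))) (locationIndicator A)

/-! ### Bounds on the distance at integer times, and monotonicity -/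

theorem tvDist_locationLaw_le {m : ℕ} (S : Finset (Fin (m + 1))) (σ : Perm (Fin (m + 1)))
    (t : ℕ) :
    tvDist (locationLaw S (topToRandom (m + 1) σ (t + 1)))
      (locationLaw S (PMF.uniformOfFintype (Perm (Fin (m + 1))))) ≤
      S.card * (1 - 1 / ((m : ℝ) + 1)) ^ t + t * (3 * S.card ^ 2 / ((m : ℝ) + 1) ^ 2) +
      2 * S.card / ((m : ℝ) + 1) := by
  refine ciSup_le fun A => ?_
  rw [locationLaw_topToRandom, locationLaw_uniform,
    ← sum_iterate_avgStep (locationIndicator A) (t + 1)]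
  have hN : (0 : ℝ) < Fintype.card (Perm (Fin (m + 1))) := by exact_mod_cast Fintype.card_pos
  set N : ℝ := (Fintype.card (Perm (Fin (m + 1))) : ℝ) with hNdef
  set G := avgStep^[t + 1] (locationIndicator A) with hG
  -- By stationarity the uniform probability is the mean of `G`, so it suffices to compare two
  -- starting decks.
  have e : G σ⁻¹ - (∑ x, G x) / N = (∑ x, (G σ⁻¹ - G x)) / N := by
    rw [Finset.sum_sub_distrib, Finset.sum_const, Finset.card_univ, nsmul_eq_mul, ← hNdef]
    field_simp
  rw [e, abs_div, abs_of_pos hN, div_le_iff₀ hN]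
  refine (Finset.abs_sum_le_sum_abs _ _).trans ?_
  refine (Finset.sum_le_card_nsmul _ _ _ fun x _ => abs_iterate_avgStep_sub_le S _
    (locationIndicator_mem_Icc A) (locationIndicator_congr A) t σ⁻¹ x).trans (le_of_eq ?_)
  rw [Finset.card_univ, nsmul_eq_mul, ← hNdef, mul_comm]

/-- Conditioning on the first step makes the later discrepancy an average of earlier ones over new
starting decks. -/
theorem tvDist_locationLaw_succ_le {m : ℕ} (S : Finset (Fin (m + 1))) (σ : Perm (Fin (m + 1)))
    (t : ℕ) :
    tvDist (locationLaw S (topToRandom (m + 1) σ (t + 1)))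
      (locationLaw S (PMF.uniformOfFintype (Perm (Fin (m + 1))))) ≤
      cardDist topToRandom S t := by
  refine ciSup_le fun A => ?_
  rw [locationLaw_topToRandom, Function.iterate_succ_apply']
  set q := ((locationLaw S (PMF.uniformOfFintype (Perm (Fin (m + 1))))).toOuterMeasure A).toReal
    with hq
  have H : ∀ x, |avgStep^[t] (locationIndicator A) x - q| ≤ cardDist topToRandom S t := by
    intro x
    have h := (le_tvDist _ _ A).trans (le_cardDist topToRandom S t x⁻¹)
    rwa [locationLaw_topToRandom, inv_inv] at h
  have e : avgStep (avgStep^[t] (locationIndicator A)) σ⁻¹ - q =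
      (∑ r, (avgStep^[t] (locationIndicator A) (swap 0 r * σ⁻¹) - q)) / ((m : ℝ) + 1) := by
    rw [Finset.sum_sub_distrib, Finset.sum_const, Finset.card_univ, nsmul_eq_mul, avgStep,
      Fintype.card_fin]
    push_cast
    field_simp
  have hm : (0 : ℝ) < (m : ℝ) + 1 := by positivity
  rw [e, abs_div, abs_of_pos hm, div_le_iff₀ hm]
  refine (Finset.abs_sum_le_sum_abs _ _).trans ?_
  refine (Finset.sum_le_card_nsmul _ _ _ fun r _ => H _).trans (le_of_eq ?_)
  rw [Finset.card_univ, nsmul_eq_mul, Fintype.card_fin, mul_comm]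
  push_cast
  rfl

theorem cardDist_antitone {m : ℕ} (S : Finset (Fin (m + 1))) :
    Antitone (cardDist topToRandom S) :=
  antitone_nat_of_succ_le fun t => ciSup_le fun σ => tvDist_locationLaw_succ_le S σ t

theorem partialDist_antitone (m k : ℕ) : Antitone (partialDist topToRandom (m + 1) k) := by
  intro s s' h
  refine partialDist_le _ _ (partialDist_nonneg _ _ _ _) fun S hS => ?_
  subst hS
  exact (cardDist_antitone S (Nat.floor_mono h)).trans (le_partialDist _ S s)

theorem partialDist_topToRandom_le (m k t : ℕ) (s : ℝ) (hs : ⌊s⌋₊ = t + 1) :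
    partialDist topToRandom (m + 1) k s ≤
      k * (1 - 1 / ((m : ℝ) + 1)) ^ t + t * (3 * k ^ 2 / ((m : ℝ) + 1) ^ 2) +
      2 * k / ((m : ℝ) + 1) := by
  have hl0 : (0 : ℝ) ≤ 1 - 1 / ((m : ℝ) + 1) := by
    rw [sub_nonneg, div_le_one (by positivity)]
    linarith [Nat.cast_nonneg (α := ℝ) m]
  refine partialDist_le _ _ (by positivity) fun S hS => ?_
  subst hS
  rw [hs]
  exact ciSup_le fun σ => tvDist_locationLaw_le S σ t

theorem sum_indicator_apply_eq {n : ℕ} (c a : Fin n) :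
    (∑ x : Perm (Fin n), if x c = a then (1 : ℝ) else 0) * n = Fintype.card (Perm (Fin n)) := by
  have h : ∀ b, (∑ x : Perm (Fin n), if x c = b then (1 : ℝ) else 0) =
      ∑ x : Perm (Fin n), if x c = a then (1 : ℝ) else 0 := by
    intro b
    refine Fintype.sum_equiv (Equiv.mulLeft (swap a b)) _ _ fun x => ?_
    simp [Equiv.swap_apply_eq_iff]
  have h2 : ∑ b, (∑ x : Perm (Fin n), if x c = b then (1 : ℝ) else 0) =
      Fintype.card (Perm (Fin n)) := by
    rw [Finset.sum_comm]
    simp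
  rw [← h2, Finset.sum_congr rfl fun b _ => h b]
  simp [mul_comm]

theorem le_partialDist_topToRandom (m k : ℕ) (hk : k ≤ m) (s : ℝ) :
    1 - k / ((m : ℝ) + 1) - (1 - (1 - 1 / ((m : ℝ) + 1)) ^ ⌊s⌋₊) ^ k ≤
      partialDist topToRandom (m + 1) k s := by
  obtain ⟨S, hS0, rfl⟩ : ∃ S : Finset (Fin (m + 1)), S ⊆ Finset.univ.erase 0 ∧ S.card = k := by
    refine Finset.exists_subset_card_eq ?_
    rw [Finset.card_erase_of_mem (Finset.mem_univ _), Finset.card_univ, Fintype.card_fin]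
    simpa using hk
  -- From the identity deck, the test event is that every tracked card has left its initial
  -- location.
  set A : Set (S → Fin (m + 1)) := {v | ∀ c : S, v c ≠ c} with hA
  refine le_trans ?_ ((le_cardDist topToRandom S ⌊s⌋₊ 1).trans (le_partialDist topToRandom S s))
  refine le_trans ?_ (le_tvDist _ _ A)
  rw [abs_sub_comm]
  refine le_trans ?_ (le_abs_self _)
  have h1 : avgStep^[⌊s⌋₊] (locationIndicator A) 1⁻¹ ≤
      (1 - (1 - 1 / ((m : ℝ) + 1)) ^ ⌊s⌋₊) ^ S.card := by
    refine iterate_avgStep_le_of_fixed 1 _ (locationIndicator_mem_Icc A) S ?_ ?_ _ _ S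
      subset_rfl (by simp)
    · intro c hc
      exact (Finset.mem_erase.1 (hS0 hc)).1
    · rintro y ⟨c, hc, hyc⟩
      refine Set.indicator_of_notMem (fun h : _ ∈ A => h ⟨c, hc⟩ hyc) _
  have hN : (0 : ℝ) < Fintype.card (Perm (Fin (m + 1))) := by exact_mod_cast Fintype.card_pos
  have hm : (0 : ℝ) < (m : ℝ) + 1 := by positivity
  have h2 : 1 - S.card / ((m : ℝ) + 1) ≤
      (∑ x, locationIndicator A x) / Fintype.card (Perm (Fin (m + 1))) := by
    rw [le_div_iff₀ hN]
    have h3 : ∀ x : Perm (Fin (m + 1)),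
        1 - ∑ c ∈ S, (if x c = c then (1 : ℝ) else 0) ≤ locationIndicator A x := by
      intro x
      by_cases hx : (fun c : S => x c) ∈ A
      · have : locationIndicator A x = 1 := Set.indicator_of_mem hx _
        rw [this, sub_le_self_iff]
        exact Finset.sum_nonneg fun c _ => by split_ifs <;> norm_num
      · refine le_trans ?_ (locationIndicator_mem_Icc A x).1
        obtain ⟨c, hc⟩ : ∃ c : S, x c = c := by
          by_contra! h
          exact hx h
        rw [sub_nonpos]
        refine le_trans (le_of_eq (if_pos hc).symm) (Finset.single_le_sum
          (f := fun c => if x c = c then (1 : ℝ) else 0)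
          (fun c _ => by split_ifs <;> norm_num) c.2)
    refine le_trans (le_of_eq ?_) (Finset.sum_le_sum fun x _ => h3 x)
    rw [Finset.sum_sub_distrib, Finset.sum_comm]
    have h4 : ∀ c ∈ S, (∑ x : Perm (Fin (m + 1)), if x c = c then (1 : ℝ) else 0) =
        Fintype.card (Perm (Fin (m + 1))) / ((m : ℝ) + 1) := by
      intro c _
      rw [eq_div_iff hm.ne', ← sum_indicator_apply_eq c c]
      push_cast
      rfl
    rw [Finset.sum_congr rfl h4]
    simp only [Finset.sum_const, Finset.card_univ, nsmul_eq_mul]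
    ring
  rw [locationLaw_topToRandom, locationLaw_uniform]
  linarith

/-! ### Exponential forms of the bounds -/

theorem partialDist_topToRandom_le_exp {n : ℕ} (hn : 1 ≤ n) (k : ℕ) {s : ℝ} (hs : 1 ≤ s) :
    partialDist topToRandom n k s ≤
      k * Real.exp (-((s - 2) / n)) + 3 * s * k ^ 2 / (n : ℝ) ^ 2 + 2 * k / n := by
  obtain ⟨m, rfl⟩ : ∃ m, n = m + 1 := ⟨n - 1, by omega⟩
  have h1 : 1 ≤ ⌊s⌋₊ := (Nat.one_le_floor_iff s).2 hs
  obtain ⟨t, ht⟩ : ∃ t, ⌊s⌋₊ = t + 1 := ⟨⌊s⌋₊ - 1, by omega⟩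
  refine (partialDist_topToRandom_le m k t s ht).trans ?_
  have hm : (0 : ℝ) < (m : ℝ) + 1 := by positivity
  have hts : (t : ℝ) + 1 ≤ s := by
    have := Nat.floor_le (zero_le_one.trans hs)
    rw [ht] at this
    exact_mod_cast this
  -- One unit is lost to the preliminary step of the coupling, another to rounding down.
  have hst : s - 2 ≤ t := by
    have := Nat.lt_floor_add_one s
    rw [ht] at this
    push_cast at this
    linarith
  have hl0 : (0 : ℝ) ≤ 1 - 1 / ((m : ℝ) + 1) := by
    rw [sub_nonneg, div_le_one (by positivity)]
    linarith [Nat.cast_nonneg (α := ℝ) m]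
  have hp : (1 - 1 / ((m : ℝ) + 1)) ^ t ≤ Real.exp (-((s - 2) / ((m : ℝ) + 1))) := by
    calc (1 - 1 / ((m : ℝ) + 1)) ^ t ≤ Real.exp (-(1 / ((m : ℝ) + 1))) ^ t :=
          pow_le_pow_left₀ hl0 (Real.one_sub_le_exp_neg _) t
      _ = Real.exp (-(t / ((m : ℝ) + 1))) := by
          rw [← Real.exp_nat_mul]; congr 1; ring
      _ ≤ _ := by gcongr
  push_cast
  have h2 : t * (3 * (k : ℝ) ^ 2 / ((m : ℝ) + 1) ^ 2) ≤ 3 * s * k ^ 2 / ((m : ℝ) + 1) ^ 2 := by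
    rw [mul_div_assoc', mul_comm (t : ℝ), mul_assoc 3 s, mul_comm s, mul_assoc 3]
    gcongr
    linarith
  gcongr

theorem exp_neg_div_le_pow_floor {n : ℕ} (hn : 2 ≤ n) {s : ℝ} (hs : 0 ≤ s) :
    Real.exp (-(s / ((n : ℝ) - 1))) ≤ (1 - 1 / (n : ℝ)) ^ ⌊s⌋₊ := by
  have hn' : (2 : ℝ) ≤ n := by exact_mod_cast hn
  have h1 : (0 : ℝ) < (n : ℝ) - 1 := by linarith
  have h2 : Real.exp (-(1 / ((n : ℝ) - 1))) ≤ 1 - 1 / (n : ℝ) := by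
    rw [Real.exp_neg]
    have h3 : 1 - 1 / (n : ℝ) = (1 + 1 / ((n : ℝ) - 1))⁻¹ := by
      field_simp; ring
    rw [h3]
    gcongr
    linarith [Real.add_one_le_exp (1 / ((n : ℝ) - 1))]
  calc Real.exp (-(s / ((n : ℝ) - 1))) ≤ Real.exp (-(⌊s⌋₊ / ((n : ℝ) - 1))) := by
        gcongr; exact Nat.floor_le hs
    _ = Real.exp (-(1 / ((n : ℝ) - 1))) ^ ⌊s⌋₊ := by
        rw [← Real.exp_nat_mul]; congr 1; ring
    _ ≤ _ := pow_le_pow_left₀ (Real.exp_pos _).le h2 _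

theorem le_partialDist_topToRandom' {n k : ℕ} (hk : k < n) (s : ℝ) :
    1 - k / (n : ℝ) - (1 - (1 - 1 / (n : ℝ)) ^ ⌊s⌋₊) ^ k ≤ partialDist topToRandom n k s := by
  obtain ⟨m, rfl⟩ : ∃ m, n = m + 1 := ⟨n - 1, by omega⟩
  simpa using le_partialDist_topToRandom m k (by omega) s

theorem partialDist_isBoundedUnder_le (P : Shuffle) (k : ℕ → ℕ) (s : ℕ → ℝ) :
    IsBoundedUnder (· ≤ ·) atTop (fun n => partialDist P n (k n) (s n)) :=
  isBoundedUnder_of ⟨1, fun _ => partialDist_le_one _ _ _ _⟩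

theorem partialDist_isBoundedUnder_ge (P : Shuffle) (k : ℕ → ℕ) (s : ℕ → ℝ) :
    IsBoundedUnder (· ≥ ·) atTop (fun n => partialDist P n (k n) (s n)) :=
  isBoundedUnder_of ⟨0, fun _ => partialDist_nonneg _ _ _ _⟩

/-! ### Cutoff for growing k -/

theorem tendsto_sq_mul_log_div {k : ℕ → ℕ}
    (hk : (fun n : ℕ => (k n : ℝ)) =o[atTop]
      (fun n : ℕ => ((n : ℝ) / Real.log (n : ℝ)) ^ (1 / 2 : ℝ))) :
    Tendsto (fun n : ℕ => (k n : ℝ) ^ 2 * Real.log n / n) atTop (𝓝 0) := by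
  have h1 := (hk.pow (n := 2) two_pos).tendsto_div_nhds_zero
  refine h1.congr' ?_
  filter_upwards [eventually_ge_atTop 2] with n hn
  have hn' : (2 : ℝ) ≤ n := by exact_mod_cast hn
  have hlog : 0 < Real.log n := Real.log_pos (by linarith)
  rw [← Real.sqrt_eq_rpow, Real.sq_sqrt (by positivity), div_div_eq_mul_div]

theorem tendsto_div_of_isLittleO_sqrt {k : ℕ → ℕ}
    (hk : (fun n : ℕ => (k n : ℝ)) =o[atTop]
      (fun n : ℕ => ((n : ℝ) / Real.log (n : ℝ)) ^ (1 / 2 : ℝ))) :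
    Tendsto (fun n : ℕ => (k n : ℝ) / n) atTop (𝓝 0) := by
  refine tendsto_of_tendsto_of_tendsto_of_le_of_le' tendsto_const_nhds
    (tendsto_sq_mul_log_div hk) (Eventually.of_forall fun n => by positivity) ?_
  filter_upwards [eventually_ge_atTop 3] with n hn
  have hlog : 1 ≤ Real.log n := by
    rw [Real.le_log_iff_exp_le (by positivity)]
    have : (3 : ℝ) ≤ n := by exact_mod_cast hn
    linarith [Real.exp_one_lt_d9]
  gcongr
  have h1 : (k n : ℝ) ≤ (k n : ℝ) ^ 2 := by exact_mod_cast Nat.le_self_pow two_ne_zero _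
  nlinarith [sq_nonneg (k n : ℝ)]

theorem limsup_partialDist_le {k : ℕ → ℕ}
    (hk : (fun n : ℕ => (k n : ℝ)) =o[atTop]
      (fun n : ℕ => ((n : ℝ) / Real.log (n : ℝ)) ^ (1 / 2 : ℝ)))
    (hk' : Tendsto k atTop atTop) {α : ℝ} (hα : 0 ≤ α) :
    limsup (fun n : ℕ => partialDist topToRandom n (k n) (n * Real.log (k n) + α * n)) atTop ≤
      Real.exp (-α) := by
  have hkn := tendsto_div_of_isLittleO_sqrt hk
  have hlim : Tendsto (fun n : ℕ => Real.exp (-α) * Real.exp (2 / (n : ℝ)) +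
      3 * (1 + α) * ((k n : ℝ) ^ 2 * Real.log n / n) + 2 * ((k n : ℝ) / n)) atTop
      (𝓝 (Real.exp (-α))) := by
    have h1 : Tendsto (fun n : ℕ => Real.exp (2 / (n : ℝ))) atTop (𝓝 1) := by
      rw [← Real.exp_zero]
      exact (Real.continuous_exp.tendsto 0).comp (tendsto_const_div_atTop_nhds_zero_nat 2)
    simpa using ((h1.const_mul (Real.exp (-α))).add
      ((tendsto_sq_mul_log_div hk).const_mul (3 * (1 + α)))).add (hkn.const_mul 2)
  rw [← hlim.limsup_eq]
  refine limsup_le_limsup ?_ (partialDist_isBoundedUnder_ge _ _ _).isCoboundedUnder_le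
    hlim.isBoundedUnder_le
  filter_upwards [eventually_ge_atTop 3, hk'.eventually_ge_atTop 3,
    hkn.eventually_le_const zero_lt_one] with n hn hkn3 hkle
  have hn' : (3 : ℝ) ≤ n := by exact_mod_cast hn
  have hk3 : (3 : ℝ) ≤ k n := by exact_mod_cast hkn3
  have hn0 : (0 : ℝ) < n := by linarith
  have hk0 : (0 : ℝ) < k n := by linarith
  have hlogk : 1 ≤ Real.log (k n) := by
    rw [Real.le_log_iff_exp_le hk0]
    linarith [Real.exp_one_lt_d9]
  have hkn' : (k n : ℝ) ≤ n := by rwa [div_le_one hn0] at hkle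
  have hlogkn : Real.log (k n) ≤ Real.log n := Real.log_le_log hk0 hkn'
  have hs : 1 ≤ n * Real.log (k n) + α * n := by nlinarith
  refine (partialDist_topToRandom_le_exp (by omega) (k n) hs).trans ?_
  have e1 : (k n : ℝ) * Real.exp (-((n * Real.log (k n) + α * n - 2) / n)) =
      Real.exp (-α) * Real.exp (2 / (n : ℝ)) := by
    have : -((n * Real.log (k n) + α * n - 2) / n) = -Real.log (k n) + (-α + 2 / (n : ℝ)) := by
      field_simp; ring
    rw [this, Real.exp_add, Real.exp_add, Real.exp_neg, Real.exp_log hk0, ← mul_assoc,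
      mul_inv_cancel₀ hk0.ne', one_mul]
  have e2 : 3 * (n * Real.log (k n) + α * n) * (k n : ℝ) ^ 2 / (n : ℝ) ^ 2 ≤
      3 * (1 + α) * ((k n : ℝ) ^ 2 * Real.log n / n) := by
    have : 3 * (n * Real.log (k n) + α * n) * (k n : ℝ) ^ 2 / (n : ℝ) ^ 2 =
        3 * (k n : ℝ) ^ 2 / n * (Real.log (k n) + α) := by
      field_simp
    rw [this]
    have : 3 * (1 + α) * ((k n : ℝ) ^ 2 * Real.log n / n) =
        3 * (k n : ℝ) ^ 2 / n * ((1 + α) * Real.log n) := by ring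
    rw [this]
    gcongr
    nlinarith
  rw [e1, mul_div_assoc 2]
  linarith

theorem le_liminf_partialDist {k : ℕ → ℕ}
    (hkn : Tendsto (fun n : ℕ => (k n : ℝ) / n) atTop (𝓝 0))
    (hk' : Tendsto k atTop atTop) {α : ℝ} (hα : α ≤ 0) :
    1 - Real.exp (-Real.exp (-α)) ≤
    liminf (fun n : ℕ => partialDist topToRandom n (k n) (n * Real.log (k n) + α * n)) atTop := by
  have hlim : Tendsto (fun n : ℕ => 1 - (k n : ℝ) / n -
      Real.exp (-(Real.exp (-α) * Real.exp (-(2 * ((k n : ℝ) / n)))))) atTop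
      (𝓝 (1 - Real.exp (-Real.exp (-α)))) := by
    have hc : Continuous fun x : ℝ => 1 - x - Real.exp (-(Real.exp (-α) * Real.exp (-(2 * x)))) := by
      fun_prop
    simpa [Function.comp_def] using (hc.tendsto 0).comp hkn
  rw [← hlim.liminf_eq]
  refine liminf_le_liminf ?_ hlim.isBoundedUnder_ge
    (partialDist_isBoundedUnder_le _ _ _).isCoboundedUnder_ge
  -- Once k ≥ e^{-α}, the time n log k + αn is nonnegative.
  filter_upwards [eventually_ge_atTop 3, hk'.eventually_ge_atTop (max 1 ⌈Real.exp (-α)⌉₊),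
    hkn.eventually_lt_const zero_lt_one] with n hn hkge hklt
  have hn' : (3 : ℝ) ≤ n := by exact_mod_cast hn
  have hn0 : (0 : ℝ) < n := by linarith
  have hk1 : (1 : ℝ) ≤ k n := by exact_mod_cast (le_max_left _ _).trans hkge
  have hk0 : (0 : ℝ) < k n := by linarith
  have hkα : Real.exp (-α) ≤ k n :=
    (Nat.le_ceil _).trans (by exact_mod_cast (le_max_right _ _).trans hkge)
  have hlogα : -α ≤ Real.log (k n) := (Real.le_log_iff_exp_le hk0).2 hkα
  have hkn' : k n < n := by
    rw [div_lt_one hn0] at hklt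
    exact_mod_cast hklt
  refine le_trans ?_ (le_partialDist_topToRandom' hkn' _)
  have hs : 0 ≤ n * Real.log (k n) + α * n := by nlinarith
  have hpow := exp_neg_div_le_pow_floor (by omega : 2 ≤ n) hs
  set p := (1 - 1 / (n : ℝ)) ^ ⌊n * Real.log (k n) + α * n⌋₊ with hp
  have hp1 : p ≤ 1 := by
    refine pow_le_one₀ ?_ ?_
    · rw [sub_nonneg, div_le_one hn0]; linarith
    · rw [sub_le_self_iff]; positivity
  have hlogk : Real.log (k n) ≤ k n := (Real.log_le_sub_one_of_pos hk0).trans (by linarith)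
  -- The error 2k/n absorbs the passage from n - 1 to n, as log k ≤ k and n ≤ 2(n - 1).
  have h1 : -Real.log (k n) + (-α + -(2 * ((k n : ℝ) / n))) ≤
      -((n * Real.log (k n) + α * n) / ((n : ℝ) - 1)) := by
    have hn1 : (0 : ℝ) < (n : ℝ) - 1 := by linarith
    have : (n * Real.log (k n) + α * n) / ((n : ℝ) - 1) =
        Real.log (k n) + α + (Real.log (k n) + α) / ((n : ℝ) - 1) := by
      field_simp; ring
    rw [this]
    have : (Real.log (k n) + α) / ((n : ℝ) - 1) ≤ 2 * ((k n : ℝ) / n) := by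
      rw [mul_div_assoc', div_le_div_iff₀ hn1 hn0]
      nlinarith
    linarith
  have h2 : Real.exp (-α) * Real.exp (-(2 * ((k n : ℝ) / n))) ≤ k n * p := by
    have := (Real.exp_le_exp.2 h1).trans hpow
    rw [Real.exp_add, Real.exp_add, Real.exp_neg (Real.log _), Real.exp_log hk0,
      inv_mul_le_iff₀ hk0] at this
    exact this
  have h3 : (1 - p) ^ k n ≤ Real.exp (-(k n * p)) := by
    calc (1 - p) ^ k n ≤ Real.exp (-p) ^ k n :=
          pow_le_pow_left₀ (by linarith) (Real.one_sub_le_exp_neg p) _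
      _ = _ := by rw [← Real.exp_nat_mul]; congr 1; ring
  have h4 := Real.exp_le_exp.2 (neg_le_neg h2)
  linarith

theorem hasPartialCutoff_topToRandom {k : ℕ → ℕ}
    (hk : (fun n : ℕ => (k n : ℝ)) =o[atTop]
      (fun n : ℕ => ((n : ℝ) / Real.log (n : ℝ)) ^ (1 / 2 : ℝ)))
    (hk' : Tendsto k atTop atTop) :
    HasPartialCutoff topToRandom k (fun n => n * Real.log (k n)) (fun n => n) where
  window := by
    have hlog : Tendsto (fun n => Real.log (k n : ℝ)) atTop atTop :=
      Real.tendsto_log_atTop.comp (tendsto_natCast_atTop_atTop.comp hk')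
    have h1 : (fun _ : ℕ => (1 : ℝ)) =o[atTop] fun n => Real.log (k n : ℝ) :=
      (isLittleO_const_left).2 (Or.inr (tendsto_norm_atTop_atTop.comp hlog))
    simpa using (isBigO_refl (fun n : ℕ => (n : ℝ)) atTop).mul_isLittleO h1
  upper := by
    refine tendsto_of_tendsto_of_tendsto_of_le_of_le' tendsto_const_nhds
      (Real.tendsto_exp_neg_atTop_nhds_zero) (Eventually.of_forall fun α => ?_) ?_
    · exact le_limsup_of_frequently_le
        (Eventually.of_forall fun n => partialDist_nonneg _ _ _ _).frequently
        (partialDist_isBoundedUnder_le _ _ _)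
    · filter_upwards [eventually_ge_atTop 0] with α hα using limsup_partialDist_le hk hk' hα
  lower := by
    have hlim : Tendsto (fun α : ℝ => 1 - Real.exp (-Real.exp (-α))) atBot (𝓝 1) := by
      have : Tendsto (fun α : ℝ => Real.exp (-Real.exp (-α))) atBot (𝓝 0) :=
        Real.tendsto_exp_neg_atTop_nhds_zero.comp
          (Real.tendsto_exp_atTop.comp tendsto_neg_atBot_atTop)
      simpa using this.const_sub 1
    refine tendsto_of_tendsto_of_tendsto_of_le_of_le' hlim tendsto_const_nhds ?_
      (Eventually.of_forall fun α => ?_)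
    · filter_upwards [eventually_le_atBot 0] with α hα using
        le_liminf_partialDist (tendsto_div_of_isLittleO_sqrt hk) hk' hα
    · exact liminf_le_of_frequently_le
        (Eventually.of_forall fun n => partialDist_le_one _ _ _ _).frequently
        (partialDist_isBoundedUnder_ge _ _ _)

/-! ### No cutoff for bounded k -/

/-- A bounded number of cards is half mixed after a suitable multiple of `n` steps. -/
theorem eventually_partialDist_le_half {k : ℕ → ℕ} {K : ℕ} (hK : ∀ n, k n < K) :
    ∀ᶠ n : ℕ in atTop, partialDist topToRandom n (k n) (((K : ℝ) + 1) * n) ≤ 1 / 2 := by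
  have hlim : Tendsto (fun n : ℕ => (K : ℝ) * Real.exp (-(K + 1) + 2 / (n : ℝ)) +
      3 * (K + 1) * K ^ 2 / (n : ℝ) + 2 * K / (n : ℝ)) atTop
      (𝓝 (K * Real.exp (-(K + 1)))) := by
    have h1 : Tendsto (fun n : ℕ => Real.exp (-((K : ℝ) + 1) + 2 / (n : ℝ))) atTop
        (𝓝 (Real.exp (-(K + 1)))) := by
      have := (tendsto_const_div_atTop_nhds_zero_nat (2 : ℝ)).const_add (-((K : ℝ) + 1))
      rw [add_zero] at this
      exact (Real.continuous_exp.tendsto _).comp this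
    simpa using ((h1.const_mul (K : ℝ)).add
      (tendsto_const_div_atTop_nhds_zero_nat (3 * (K + 1) * (K : ℝ) ^ 2))).add
      (tendsto_const_div_atTop_nhds_zero_nat (2 * (K : ℝ)))
  have hlt : K * Real.exp (-((K : ℝ) + 1)) < 1 / 2 := by
    have h1 := Real.add_one_le_exp (K : ℝ)
    have h2 := Real.exp_one_gt_d9
    rw [Real.exp_neg, Real.exp_add, ← div_eq_mul_inv, div_lt_iff₀ (by positivity)]
    nlinarith [Real.exp_pos (K : ℝ)]
  filter_upwards [hlim.eventually_le_const hlt, eventually_ge_atTop 1] with n h hn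
  refine le_trans ?_ h
  have hn' : (1 : ℝ) ≤ n := by exact_mod_cast hn
  have hkK : (k n : ℝ) ≤ K := by exact_mod_cast (hK n).le
  refine (partialDist_topToRandom_le_exp hn (k n) (by nlinarith)).trans ?_
  have e1 : -((((K : ℝ) + 1) * n - 2) / n) = -(K + 1) + 2 / (n : ℝ) := by
    field_simp; ring
  have e2 : 3 * (((K : ℝ) + 1) * n) * (k n : ℝ) ^ 2 / (n : ℝ) ^ 2 =
      3 * (K + 1) * (k n : ℝ) ^ 2 / n := by
    field_simp
  rw [e1, e2]
  gcongr

/-- A nonempty bounded set of cards is not mixed after `C * n` steps. -/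
theorem eventually_le_partialDist {k : ℕ → ℕ} {K : ℕ} (hK : ∀ n, k n < K) {C : ℝ} (hC : 0 < C) :
    ∀ᶠ n : ℕ in atTop, k n ≠ 0 → ∀ s ≤ C * n,
      Real.exp (-(2 * C)) / 2 ≤ partialDist topToRandom n (k n) s := by
  filter_upwards [(tendsto_const_div_atTop_nhds_zero_nat (K : ℝ)).eventually_le_const
    (half_pos (Real.exp_pos (-(2 * C)))), eventually_ge_atTop 2, eventually_ge_atTop K]
    with n hn hn2 hnK hk0 s hs
  have hn' : (2 : ℝ) ≤ n := by exact_mod_cast hn2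
  have hn0 : (0 : ℝ) < n := by linarith
  refine le_trans ?_ (le_partialDist_topToRandom' ((hK n).trans_le hnK) s)
  have hkn : (k n : ℝ) / n ≤ K / n := by
    gcongr; exact (hK n).le
  have hfl : ⌊s⌋₊ ≤ ⌊C * n⌋₊ := Nat.floor_mono hs
  have hl0 : 0 ≤ 1 - 1 / (n : ℝ) := by
    rw [sub_nonneg, div_le_one hn0]; linarith
  have hl1 : 1 - 1 / (n : ℝ) ≤ 1 := by
    rw [sub_le_self_iff]; positivity
  have h1 : Real.exp (-(2 * C)) ≤ (1 - 1 / (n : ℝ)) ^ ⌊s⌋₊ := by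
    refine le_trans ?_ ((exp_neg_div_le_pow_floor hn2 (by positivity : 0 ≤ C * n)).trans
      (pow_le_pow_of_le_one hl0 hl1 hfl))
    gcongr
    rw [div_le_iff₀ (by linarith)]
    nlinarith
  have h2 : (1 - (1 - 1 / (n : ℝ)) ^ ⌊s⌋₊) ^ k n ≤ 1 - (1 - 1 / (n : ℝ)) ^ ⌊s⌋₊ :=
    pow_le_of_le_one (sub_nonneg.2 (pow_le_one₀ hl0 hl1))
      (sub_le_self _ (pow_nonneg hl0 _)) hk0
  linarith

theorem locationLaw_empty {n : ℕ} (p : PMF (Perm (Fin n))) :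
    locationLaw ∅ p = PMF.pure isEmptyElim := by
  rw [locationLaw, ← PMF.map_const p]
  congr 1
  funext σ
  exact Subsingleton.elim _ _

/-- Since ω = o(tmix), any two times tmix + αω with α fixed eventually differ by a factor of at most
3. Yet one with distance above 1/2 lies before εn, and one with tiny distance lies after 3εn. -/
theorem not_hasPartialCutoff_topToRandom {k : ℕ → ℕ} {K : ℕ} (hK : ∀ n, k n < K)
    (tmix ω : ℕ → ℝ) : ¬ HasPartialCutoff topToRandom k tmix ω := by
  intro h
  set ε : ℝ := (K : ℝ) + 1 with hε
  have hε0 : 0 < ε := by positivity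
  obtain ⟨α₁, hα₁⟩ := (h.upper.eventually_lt_const
    (half_pos (Real.exp_pos (-(2 * (3 * ε)))))).exists
  obtain ⟨α₀, hα₀⟩ := (h.lower.eventually_const_lt (by norm_num : (1 / 2 : ℝ) < 1)).exists
  have hω : ∀ α : ℝ, ∀ᶠ n in atTop, |α * ω n| ≤ 1 / 2 * |tmix n| := fun α => by
    simpa using (h.window.const_mul_left α).def (by norm_num : (0 : ℝ) < 1 / 2)
  have H : ∀ᶠ n : ℕ in atTop, False := by
    filter_upwards [hω α₁, hω α₀,
      eventually_lt_of_limsup_lt hα₁ (partialDist_isBoundedUnder_le _ _ _),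
      eventually_lt_of_lt_liminf hα₀ (partialDist_isBoundedUnder_ge _ _ _),
      eventually_partialDist_le_half hK,
      eventually_le_partialDist hK (by positivity : 0 < 3 * ε), eventually_ge_atTop 1]
      with n h₁ h₀ hup hlo hhalf hlow hn
    obtain ⟨m, rfl⟩ : ∃ m, n = m + 1 := ⟨n - 1, by omega⟩
    have hlt : tmix (m + 1) + α₀ * ω (m + 1) < ε * (m + 1 : ℕ) := by
      by_contra! hc
      exact absurd ((partialDist_antitone m _ hc).trans hhalf) (not_le.2 hlo)
    -- With no tracked cards the distance is 0, contradicting the lower limit 1.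
    have hk0 : k (m + 1) ≠ 0 := by
      intro h0
      have : partialDist topToRandom (m + 1) (k (m + 1))
          (tmix (m + 1) + α₀ * ω (m + 1)) ≤ 0 := by
        refine partialDist_le _ _ le_rfl fun S hS => ciSup_le fun σ => ciSup_le fun A => ?_
        rw [h0, Finset.card_eq_zero] at hS
        subst hS
        rw [locationLaw_empty, locationLaw_empty]
        simp
      linarith
    have hgt : 3 * ε * (m + 1 : ℕ) < tmix (m + 1) + α₁ * ω (m + 1) := by
      by_contra! hc
      exact absurd (hlow hk0 _ hc) (not_le.2 hup)
    have hpos : 0 ≤ ε * (m + 1 : ℕ) := by positivity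
    rw [abs_le] at h₁ h₀
    -- If `tmix` is nonnegative, the two times force both tmix < 2εn and tmix > 2εn; if it is
    -- nonpositive, the later time cannot be positive.
    rcases le_total 0 (tmix (m + 1)) with ht | ht
    · rw [abs_of_nonneg ht] at h₁ h₀
      linarith
    · rw [abs_of_nonpos ht] at h₁ h₀
      linarith
  exact H.exists.elim fun _ => id

end CardShuffle

theorem theorem3 :
    (∀ k : ℕ → ℕ,
      (fun n : ℕ => (k n : ℝ)) =o[atTop]
        (fun n : ℕ => ((n : ℝ) / Real.log (n : ℝ)) ^ (1 / 2 : ℝ)) →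
      Tendsto k atTop atTop →
      CardShuffle.HasPartialCutoff CardShuffle.topToRandom k
        (fun n : ℕ => (n : ℝ) * Real.log (k n : ℝ)) (fun n : ℕ => (n : ℝ))) ∧
    (∀ (k : ℕ → ℕ) (K : ℕ), (∀ n, k n < K) →
      ¬ ∃ tmix ω : ℕ → ℝ,
        CardShuffle.HasPartialCutoff CardShuffle.topToRandom k tmix ω) := by
  refine ⟨fun k hk hk' => CardShuffle.hasPartialCutoff_topToRandom hk hk', ?_⟩
  rintro k K hK ⟨tmix, ω, h⟩
  exact CardShuffle.not_hasPartialCutoff_topToRandom hK tmix ω h
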